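/- Let $N\ge 1$ be a fixed integer, let $A_1,\dots,A_N$ be almost surely positive random variables on a common probability space, and let $X_0$ be a real random variable with law $F_0$ and characteristic function $\phi_0$. For characteristic functions $\phi_1,\dots,\phi_N$ put $$\widehat Q(\phi_1,\dots,\phi_N)(\xi)=\mathbb E\bigl[\phi_1(A_1\xi)\cdots\phi_N(A_N\xi)\bigr],\qquad \xi\in\mathbb R .$$ Consider the Cauchy problem $$\partial_t\phi(t,\xi)+\phi(t,\xi)=\widehat Q(\phi(t,\cdot),\dots,\phi(t,\cdot))(\xi)\quad(t>0),\qquad \phi(0,\xi)=\phi_0(\xi),\qquad \xi\in\mathbb R,$$ where a solution is a function $\phi:[0,\infty)\times\mathbb R\to\mathbb C$ such that $\phi(t,\cdot)$ is the characteristic function of a probability measure on $\mathbb R$ for every $t\ge0$, $t\mapsto\phi(t,\xi)$ is continuous on $[0,\infty)$ and differentiable on $(0,\infty)$ for every $\xi$, and the two equations hold pointwise. Continuous-time branching random walk: a single initial particle is located at $0$; every particle $v$ lives for an exponential time with parameter $1$, then dies and is replaced by $N$ children, displaced from the position of $v$ by the components of a random vector $(Z_1(v),\dots,Z_N(v))$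 distributed as $(\log A_1,\dots,\log A_N)$; all lifetimes and all displacement vectors are independent. Let $\mathcal Y_t$ be the number of particles present at time $t$ (a Yule process), let $z_{1,t},\dots,z_{\mathcal Y_t,t}$ be their locations, listed in any measurable way, and let $\mathcal Z_t=\sum_{k=1}^{\mathcal Y_t}\delta_{z_{k,t}}$. The associated smoothing transform $\mathcal L_t$ maps a probability law $\nu$ on $\mathbb R$ to the law of $\sum_{k=1}^{\mathcal Y_t}e^{z_{k,t}}U_k$, where $U_1,U_2,\dots$ are i.i.d. with law $\nu$ and independent of the walk and of the listing of its particles. Then the Cauchy problem has a unique solution $\phi$. Moreover, for every such branching random walk $(\mathcal Z_t)_{t\ge0}$, and every i.i.d. sequence $X_1,X_2,\dots$ with law $F_0$ that is defined on the same probability space and independent of the walk and of the listing of its particles, $$\phi(t,\xi)=\mathbb E\exp\Bigl(i\xi\sum_{k=1}^{\mathcal Y_t}e^{z_{k,t}}X_k\Bigr),\qquad t\ge0,\ \xi\in\mathbb R;$$ that is, $\phi(t,\cdot)$ is the characteristic function of $\mathcal L_t(F_0)$. -/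

import Mathlib

namespace KineticBRW

open MeasureTheory ProbabilityTheory

noncomputable section

/-! ### The Cauchy problem -/

/-- The smoothing transform `Q̂(φ₁, …, φ_N)(ξ) = 𝔼 (φ₁(A₁ ξ) ⋯ φ_N(A_N ξ))`. -/
def smoothingOp {N : ℕ} {Ω : Type*} [MeasurableSpace Ω] (P : Measure Ω) (A : Fin N → Ω → ℝ)
    (φ : Fin N → ℝ → ℂ) (ξ : ℝ) : ℂ :=
  ∫ ω, ∏ i, φ i (A i ω * ξ) ∂P

/-- `φ` is a solution of `∂ₜ φ + φ = Q̂(φ, …, φ)` for `t > 0`, `φ(0, ·) = 𝔼 exp(i · X₀)`: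
at each time `t ≥ 0` it is the characteristic function of a probability measure `ρ_t`, it is
continuous in time up to `t = 0`, and the equation holds pointwise, in the classical sense.
Values at negative times are irrelevant. -/
structure IsSolution {N : ℕ} {Ω : Type*} [MeasurableSpace Ω] (P : Measure Ω)
    (A : Fin N → Ω → ℝ) (X₀ : Ω → ℝ) (φ : ℝ → ℝ → ℂ) : Prop where
  charFun_of_prob : ∀ t : ℝ, 0 ≤ t →
    ∃ ρ : Measure ℝ, IsProbabilityMeasure ρ ∧ ∀ ξ, φ t ξ = charFun ρ ξ
  initial : ∀ ξ, φ 0 ξ = charFun (P.map X₀) ξ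
  continuous_time : ∀ ξ, ContinuousOn (fun t => φ t ξ) (Set.Ici 0)
  equation : ∀ t : ℝ, 0 < t → ∀ ξ : ℝ, ∃ d : ℂ, HasDerivAt (fun s => φ s ξ) d t ∧
    d + φ t ξ = smoothingOp P A (fun _ => φ t) ξ

/-! ### The continuous-time branching random walk

Particles are words over `Fin N`: the initial particle is `[]`, and `i :: v` is the `i`-th child
of `v`. The particle `v` lives for the time `τ v`, then dies and is replaced by its `N` children,
the `i`-th one displaced by `D v i` from the position of `v`. -/

/-- Time at which the particle `v` is born. -/
def birth {N : ℕ} (τ : List (Fin N) → ℝ) : List (Fin N) → ℝ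
  | [] => 0
  | _ :: v => birth τ v + τ v

/-- Position of the particle `v`. -/
def position {N : ℕ} (D : List (Fin N) → Fin N → ℝ) : List (Fin N) → ℝ
  | [] => 0
  | i :: v => position D v + D v i

/-- The particles present at time `t`. -/
def alive {N : ℕ} (τ : List (Fin N) → ℝ) (t : ℝ) : Set (List (Fin N)) :=
  {v | birth τ v ≤ t ∧ t < birth τ v + τ v}

/-- The Yule process `𝒴_t`: the number of particles present at time `t`. -/
def yule {N : ℕ} (τ : List (Fin N) → ℝ) (t : ℝ) : ℕ := (alive τ t).ncard

/-- The branching random walk `𝒵_t = ∑ δ_{position}`, the sum over the particles present at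
time `t`. -/
def walk {N : ℕ} (τ : List (Fin N) → ℝ) (D : List (Fin N) → Fin N → ℝ) (t : ℝ) : Measure ℝ :=
  Measure.sum fun v : alive τ t => Measure.dirac (position D v)

/-- `τ`, `D` are the lifetimes and displacements of a branching random walk whose displacement
vectors have law `κ`: the pairs `(τ v, D v)` are i.i.d. over all particles `v`, the lifetime is
exponential with parameter `1`, and independent of the displacement vector. -/
structure IsBranchingRandomWalk {N : ℕ} {Ω : Type*} [MeasurableSpace Ω] (P : Measure Ω)
    (κ : Measure (Fin N → ℝ)) (τ : List (Fin N) → Ω → ℝ)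
    (D : List (Fin N) → Ω → Fin N → ℝ) : Prop where
  measurable_lifetime : ∀ v, Measurable (τ v)
  measurable_displacement : ∀ v, Measurable (D v)
  law : ∀ v, P.map (fun ω => (τ v ω, D v ω)) = (expMeasure 1).prod κ
  indep : iIndepFun (fun v ω => (τ v ω, D v ω)) P

/-- `z t 0, z t 1, …, z t (𝒴_t - 1)` are the locations of the particles present at time `t`,
listed in an arbitrary measurable way: `𝒵_t = ∑_{k < 𝒴_t} δ_{z t k}` almost surely where only
finitely many particles are present. -/
structure IsLocationList {N : ℕ} {Ω : Type*} [MeasurableSpace Ω] (P : Measure Ω)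
    (τ : List (Fin N) → Ω → ℝ) (D : List (Fin N) → Ω → Fin N → ℝ)
    (z : ℝ → ℕ → Ω → ℝ) : Prop where
  measurable_location : ∀ t k, Measurable (z t k)
  walk_eq : ∀ t : ℝ, 0 ≤ t → ∀ᵐ ω ∂P, (alive (fun v => τ v ω) t).Finite →
    walk (fun v => τ v ω) (fun v => D v ω) t =
      ∑ k ∈ Finset.range (yule (fun v => τ v ω) t), Measure.dirac (z t k ω)

/-- The sum `∑_{k < 𝒴_t} exp(z_{k,t}) x_k`. -/
def weightedSum {N : ℕ} {Ω : Type*} (τ : List (Fin N) → Ω → ℝ) (z : ℝ → ℕ → Ω → ℝ) (t : ℝ)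
    (ω : Ω) (x : ℕ → ℝ) : ℝ :=
  ∑ k ∈ Finset.range (yule (fun v => τ v ω) t), Real.exp (z t k ω) * x k

/-- The smoothing transform `ℒ_t` associated with the branching random walk, acting on probability
distributions on `ℝ`: `ℒ_t(ν)` is the law of `∑_{k < 𝒴_t} exp(z_{k,t}) U_k`, where the `U_k` are
i.i.d. with law `ν` and independent of the walk (realized on a product space). -/
def smoothingTransform {N : ℕ} {Ω : Type*} [MeasurableSpace Ω] (P : Measure Ω)
    (τ : List (Fin N) → Ω → ℝ) (z : ℝ → ℕ → Ω → ℝ) (t : ℝ) (ν : Measure ℝ)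
    [IsProbabilityMeasure ν] : Measure ℝ :=
  (P.prod (Measure.infinitePi fun _ : ℕ => ν)).map fun p => weightedSum τ z t p.1 p.2

/-- `X 0, X 1, …` are i.i.d. with law `ν`, and independent at each time `t ≥ 0` of the
configuration `(𝒴_t, (z_{k,t})_k)` of the branching random walk. -/
structure IsInitialSample {N : ℕ} {Ω : Type*} [MeasurableSpace Ω] (P : Measure Ω)
    (ν : Measure ℝ) (τ : List (Fin N) → Ω → ℝ) (z : ℝ → ℕ → Ω → ℝ) (X : ℕ → Ω → ℝ) : Prop where
  measurable_sample : ∀ k, Measurable (X k)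
  law : ∀ k, P.map (X k) = ν
  indep : iIndepFun X P
  indep_walk : ∀ t : ℝ, 0 ≤ t →
    IndepFun (fun ω => (yule (fun v => τ v ω) t, fun k => z t k ω)) (fun ω k => X k ω) P

end

end KineticBRW

/-! Let `g` be the initial characteristic function. The solution is
`φ(t, ξ) = 𝔼 ∏ g(exp(position) ξ)`, the product over the particles present at time `t`, which are
almost surely finitely many because `𝔼 ∑ exp(-N · birth time)` over all particles is a convergent
geometric series. Conditioning on the lifetime and the displacements of the initial particle, whose
children start independent copies of the walk, turns this formula into the Duhamel form
`φ(t, ξ) = exp(-t) (g(ξ) + ∫₀ᵗ exp(u) Q̂(φ(u, ·))(ξ) du)` of the equation. For uniqueness, if two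
solutions differ by at most `C exp(2 (N + 1) t)`, the equation halves the constant `C`. Conditioning
on the walk identifies `φ(t, ·)` with the characteristic function of the random sum. -/

namespace KineticBRW

open MeasureTheory ProbabilityTheory Filter Topology

noncomputable section

@[to_additive]
lemma measurable_finprod {ι α M : Type*} [Countable ι] [MeasurableSpace α] [CommMonoid M]
    [MeasurableSpace M] [MeasurableSingletonClass M] [MeasurableMul₂ M] {f : ι → α → M}
    (hf : ∀ i, Measurable (f i)) : Measurable fun x => ∏ᶠ i, f i x := by
  set t : Finset ι → Set α := fun s => ⋂ i ∉ s, {x | f i x = 1} with ht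
  have mem_t {s : Finset ι} {x : α} : x ∈ t s ↔ (Function.mulSupport fun i => f i x) ⊆ s := by
    simp [ht, Set.subset_def, not_imp_comm]
  have htm (s : Finset ι) : MeasurableSet (t s) :=
    .iInter fun i => .iInter fun _ => hf i (measurableSet_singleton 1)
  set p : Option (Finset ι) → α → M := fun o x => o.elim 1 fun s => ∏ i ∈ s, f i x
  have heq : ∀ o, Set.EqOn (fun x => ∏ᶠ i, f i x) (p o) (o.elim (⋃ s, t s)ᶜ t)
    | none => fun x hx => finprod_of_infinite_mulSupport fun hfin =>
        hx (Set.mem_iUnion.2 ⟨hfin.toFinset, mem_t.2 (by simp)⟩)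
    | some s => fun x hx => finprod_eq_prod_of_mulSupport_subset _ (mem_t.1 hx)
  have hpm : ∀ o, Measurable (p o)
    | none => measurable_const
    | some s => s.measurable_prod fun i _ => hf i
  have hum : ∀ o : Option (Finset ι), MeasurableSet (o.elim (⋃ s, t s)ᶜ t)
    | none => (MeasurableSet.iUnion htm).compl
    | some s => htm s
  obtain ⟨g, hg, hgp⟩ := exists_measurable_piecewise _ hum p hpm
    fun o o' _ x hx => (heq o hx.1).symm.trans (heq o' hx.2)
  convert! hg with x
  by_cases hx : x ∈ ⋃ s, t s
  · obtain ⟨s, hs⟩ := Set.mem_iUnion.1 hx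
    exact (heq (some s) hs).trans (hgp (some s) hs).symm
  · exact (heq none hx).trans (hgp none hx).symm

@[to_additive]
lemma measurable_finprod_mem {ι α M : Type*} [Countable ι] [MeasurableSpace α] [CommMonoid M]
    [MeasurableSpace M] [MeasurableSingletonClass M] [MeasurableMul₂ M] {s : α → Set ι}
    {f : ι → α → M} (hs : ∀ i, MeasurableSet {x | i ∈ s x}) (hf : ∀ i, Measurable (f i)) :
    Measurable fun x => ∏ᶠ i ∈ s x, f i x := by
  classical
  simp only [finprod_mem_def, Set.mulIndicator_apply]
  exact measurable_finprod fun i => .ite (hs i) (hf i) measurable_const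

lemma norm_finprod_mem_le_one {ι : Type*} {s : Set ι} {f : ι → ℂ} (hf : ∀ i ∈ s, ‖f i‖ ≤ 1) :
    ‖∏ᶠ i ∈ s, f i‖ ≤ 1 := by
  refine finprod_mem_induction (fun z => ‖z‖ ≤ 1) (by simp) (fun z w hz hw => ?_) hf
  rw [norm_mul]
  exact mul_le_one₀ hz (norm_nonneg _) hw

lemma norm_prod_le_one {ι : Type*} (s : Finset ι) {f : ι → ℂ} (hf : ∀ i ∈ s, ‖f i‖ ≤ 1) :
    ‖∏ i ∈ s, f i‖ ≤ 1 :=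
  (s.norm_prod_le f).trans (Finset.prod_le_one (fun _ _ => norm_nonneg _) hf)

lemma infinitePi_map_eval_prod_comp {ι α E : Type*} [MeasurableSpace E] (ρ : Measure E)
    [IsProbabilityMeasure ρ] {j : ι} {f : α → ι} (hf : Function.Injective f) (hj : ∀ a, f a ≠ j) :
    (Measure.infinitePi fun _ : ι => ρ).map (fun x => (x j, fun a => x (f a))) =
      ρ.prod (Measure.infinitePi fun _ : α => ρ) := by
  classical
  have hind : iIndepFun (fun i (x : ι → E) => x i) (Measure.infinitePi fun _ => ρ) :=
    iIndepFun_infinitePi (X := fun _ y => y) fun _ => measurable_id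
  have hroot : IndepFun (fun x : ι → E => x j) (fun x a => x (f a))
      (Measure.infinitePi fun _ => ρ) := by
    refine IndepFun.indepFun_process (by fun_prop) (by fun_prop) fun I => ?_
    have h := hind.indepFun_finset {j} (I.image f) (by simp [hj]) fun i => by fun_prop
    have hψ : Measurable fun (y : I.image f → E) (a : I) =>
        y ⟨f a, Finset.mem_image_of_mem f a.2⟩ :=
      measurable_pi_lambda _ fun _ => measurable_pi_apply _
    exact h.comp (measurable_pi_apply (⟨j, by simp⟩ : ({j} : Finset ι))) hψ
  rw [hroot.map_prod_eq_prod_map_map (measurable_pi_apply j).aemeasurable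
    (measurable_pi_lambda _ fun _ => measurable_pi_apply _).aemeasurable,
    Measure.infinitePi_map_eval, Measure.map_infinitePi_infinitePi_of_inj hf]

lemma infinitePi_map_root_subtrees {N : ℕ} {E : Type*} [MeasurableSpace E] (ρ : Measure E)
    [IsProbabilityMeasure ρ] :
    (Measure.infinitePi fun _ : List (Fin N) => ρ).map
        (fun x => (x [], fun i w => x (w ++ [i]))) =
      ρ.prod (Measure.pi fun _ : Fin N => Measure.infinitePi fun _ : List (Fin N) => ρ) := by
  have hinj : Function.Injective fun p : Fin N × List (Fin N) => p.2 ++ [p.1] := by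
    rintro ⟨i, v⟩ ⟨j, w⟩ h
    simpa [and_comm] using h
  rw [← Measure.infinitePi_eq_pi, ← Measure.infinitePi_map_curry fun _ _ => ρ]
  nth_rw 2 [← Measure.map_id (μ := ρ)]
  rw [Measure.map_prod_map _ _ measurable_id (by fun_prop),
    ← infinitePi_map_eval_prod_comp ρ hinj (j := []) (by simp),
    Measure.map_map (by fun_prop) (by fun_prop)]
  rfl

lemma count_map_eq_sum_dirac {ι α : Type*} [DecidableEq α] [MeasurableSpace α]
    [MeasurableSingletonClass α] (s : Finset ι) (f : ι → α) (a : α) :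
    ((s.val.map f).count a : ENNReal) = (∑ i ∈ s, Measure.dirac (f i)) {a} := by
  simp only [Multiset.count_map, Measure.finsetSum_apply, Measure.dirac_apply,
    Set.indicator_apply, Set.mem_singleton_iff, Pi.one_apply, Finset.sum_boole, eq_comm]
  rfl

lemma map_eq_map_of_sum_dirac_eq {ι ι' α : Type*} [MeasurableSpace α]
    [MeasurableSingletonClass α] {s : Finset ι} {s' : Finset ι'} {f : ι → α} {f' : ι' → α}
    (h : ∑ i ∈ s, Measure.dirac (f i) = ∑ j ∈ s', Measure.dirac (f' j)) :
    s.val.map f = s'.val.map f' := by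
  classical
  ext a
  have := congrArg (fun μ : Measure α => μ {a}) h
  simp only [← count_map_eq_sum_dirac] at this
  exact_mod_cast this

lemma prod_eq_prod_of_sum_dirac_eq {ι ι' α M : Type*} [MeasurableSpace α]
    [MeasurableSingletonClass α] [CommMonoid M] {s : Finset ι} {s' : Finset ι'} {f : ι → α}
    {f' : ι' → α} (h : ∑ i ∈ s, Measure.dirac (f i) = ∑ j ∈ s', Measure.dirac (f' j))
    (g : α → M) : ∏ i ∈ s, g (f i) = ∏ j ∈ s', g (f' j) := by
  have := congrArg (fun m => (m.map g).prod) (map_eq_map_of_sum_dirac_eq h)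
  rwa [Multiset.map_map, Multiset.map_map] at this

lemma charFun_map_prod {α β : Type*} [MeasurableSpace α] [MeasurableSpace β] {μ : Measure α}
    {ρ : Measure β} [IsFiniteMeasure μ] [IsFiniteMeasure ρ] {T : α × β → ℝ} (hT : Measurable T)
    (ξ : ℝ) :
    charFun ((μ.prod ρ).map T) ξ = ∫ x, charFun (ρ.map fun y => T (x, y)) ξ ∂μ := by
  have hexp : Integrable (fun p => Complex.exp (ξ * T p * Complex.I)) (μ.prod ρ) := by
    refine .of_bound (Measurable.aestronglyMeasurable (by fun_prop)) 1 (ae_of_all _ fun p => ?_)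
    exact_mod_cast (Complex.norm_exp_ofReal_mul_I (ξ * T p)).le
  rw [charFun_apply_real, integral_map hT.aemeasurable (by fun_prop), integral_prod _ hexp]
  refine integral_congr_ae (ae_of_all _ fun x => ?_)
  have hTx : Measurable fun y => T (x, y) := hT.comp measurable_prodMk_left
  exact ((charFun_apply_real _).trans
    (integral_map hTx.aemeasurable (by fun_prop))).symm

lemma charFun_map_sum_mul_infinitePi {ι : Type*} (ν : Measure ℝ) [IsProbabilityMeasure ν]
    (s : Finset ι) (a : ι → ℝ) (ξ : ℝ) :
    charFun ((Measure.infinitePi fun _ : ι => ν).map fun x => ∑ k ∈ s, a k * x k) ξ =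
      ∏ k ∈ s, charFun ν (a k * ξ) := by
  have hind : iIndepFun (fun k (x : ι → ℝ) => a k * x k) (Measure.infinitePi fun _ : ι => ν) :=
    iIndepFun_infinitePi (X := fun k y => a k * y) fun k => by fun_prop
  have hlaw (k : ι) : (Measure.infinitePi fun _ : ι => ν).map (fun x => a k * x k) =
      ν.map (a k * ·) := by
    rw [← Measure.infinitePi_map_eval (fun _ : ι => ν) k, Measure.map_map (by fun_prop)
      (by fun_prop), Measure.infinitePi_map_eval]
    rfl
  rw [(hind.restrict s).charFun_map_fun_finsetSum_eq_prod
    fun k _ => Measurable.aemeasurable (by fun_prop), Finset.prod_apply]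
  simp only [hlaw, charFun_map_mul]

lemma norm_le_of_norm_deriv_le {E : Type*} [NormedAddCommGroup E] [NormedSpace ℝ E]
    {f f' : ℝ → E} {B B' : ℝ → ℝ} {a b : ℝ} (hab : a ≤ b) (hf : ContinuousOn f (Set.Icc a b))
    (hf' : ∀ s ∈ Set.Ioo a b, HasDerivAt f (f' s) s) (hB : ContinuousOn B (Set.Icc a b))
    (hB' : ∀ s ∈ Set.Ioo a b, HasDerivAt B (B' s) s) (ha : ‖f a‖ ≤ B a)
    (hle : ∀ s ∈ Set.Ioo a b, ‖f' s‖ ≤ B' s) : ‖f b‖ ≤ B b := by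
  rcases hab.eq_or_lt with rfl | hab
  · exact ha
  have hle_of_mem : ∀ ε ∈ Set.Ioo a b, ‖f b‖ ≤ ‖f ε‖ - B ε + B b := fun ε hε => by
    have hIcc : Set.Icc ε b ⊆ Set.Icc a b := Set.Icc_subset_Icc_left hε.1.le
    have hIco : Set.Ico ε b ⊆ Set.Ioo a b := fun s hs => ⟨hε.1.trans_le hs.1, hs.2⟩
    exact image_norm_le_of_norm_deriv_right_le_deriv_boundary' (hf.mono hIcc)
      (fun s hs => (hf' s (hIco hs)).hasDerivWithinAt) (B := fun s => ‖f ε‖ - B ε + B s) (by simp)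
      (continuousOn_const.add (hB.mono hIcc))
      (fun s hs => ((hB' s (hIco hs)).const_add _).hasDerivWithinAt)
      (fun s hs => hle s (hIco hs)) ⟨hε.2.le, le_rfl⟩
  have hlim : Tendsto (fun ε => ‖f ε‖ - B ε + B b) (𝓝[>] a) (𝓝 (‖f a‖ - B a + B b)) := by
    have hcont : ContinuousOn (fun ε => ‖f ε‖ - B ε + B b) (Set.Icc a b) :=
      (hf.norm.sub hB).add continuousOn_const
    rw [← nhdsWithin_Ioo_eq_nhdsGT hab]
    exact (hcont a (Set.left_mem_Icc.2 hab.le)).mono_left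
      (nhdsWithin_mono a Set.Ioo_subset_Icc_self)
  have := ge_of_tendsto hlim (eventually_of_mem (Ioo_mem_nhdsGT hab) hle_of_mem)
  linarith

/-- The variation of constants formula for the solution of `y' + y = G`, `y 0 = c`. -/
def duhamel {E : Type*} [NormedAddCommGroup E] [NormedSpace ℝ E] (c : E) (G : ℝ → E) (t : ℝ) : E :=
  Real.exp (-t) • (c + ∫ u in (0 : ℝ)..t, Real.exp u • G u)

section

variable {E : Type*} [NormedAddCommGroup E] [NormedSpace ℝ E] {G : ℝ → E}

@[simp]
lemma duhamel_zero (c : E) (G : ℝ → E) : duhamel c G 0 = c := by simp [duhamel]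

lemma continuous_duhamel (c : E) (hG : ∀ a b, IntervalIntegrable G volume a b) :
    Continuous (duhamel c G) := by
  have hprim : Continuous fun t => ∫ u in (0 : ℝ)..t, Real.exp u • G u :=
    intervalIntegral.continuous_primitive
      (fun a b => (hG a b).continuousOn_smul Real.continuous_exp.continuousOn) 0
  unfold duhamel
  fun_prop

lemma hasDerivAt_duhamel [CompleteSpace E] (c : E) {t : ℝ} (hG : IntervalIntegrable G volume 0 t)
    (hGm : StronglyMeasurable G) (hGt : ContinuousAt G t) :
    HasDerivAt (duhamel c G) (G t - duhamel c G t) t := by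
  have hprim : HasDerivAt (fun s => ∫ u in (0 : ℝ)..s, Real.exp u • G u) (Real.exp t • G t) t :=
    intervalIntegral.integral_hasDerivAt_right
      (hG.continuousOn_smul Real.continuous_exp.continuousOn)
      (Real.continuous_exp.stronglyMeasurable.smul hGm).stronglyMeasurableAtFilter
      (Real.continuous_exp.continuousAt.smul hGt)
  convert! (hasDerivAt_neg t).exp.smul (hprim.const_add c) using 1
  simp [duhamel, smul_smul, ← Real.exp_add, sub_eq_add_neg, add_comm]

instance isProbabilityMeasure_expMeasure_one : IsProbabilityMeasure (expMeasure 1) :=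
  isProbabilityMeasure_expMeasure one_pos

lemma measurable_exponentialPDF (r : ℝ) : Measurable (exponentialPDF r) :=
  (measurable_exponentialPDFReal r).ennreal_ofReal

lemma ae_nonneg_expMeasure (r : ℝ) : ∀ᵐ s ∂expMeasure r, 0 ≤ s := by
  refine (ae_withDensity_iff (measurable_exponentialPDF r)).2 (ae_of_all _ fun s hs => ?_)
  contrapose! hs
  exact exponentialPDF_of_neg hs

lemma lintegral_exp_neg_mul_expMeasure {a : ℝ} (ha : 0 ≤ a) :
    ∫⁻ s, ENNReal.ofReal (Real.exp (-(a * s))) ∂expMeasure 1 = ENNReal.ofReal (1 + a)⁻¹ := by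
  have ha' : 0 < 1 + a := by linarith
  have htilt (s : ℝ) : exponentialPDF 1 s * ENNReal.ofReal (Real.exp (-(a * s))) =
      ENNReal.ofReal (1 + a)⁻¹ * exponentialPDF (1 + a) s := by
    simp only [exponentialPDF_eq]
    rw [← ENNReal.ofReal_mul' (Real.exp_pos _).le, ← ENNReal.ofReal_mul (by positivity)]
    split_ifs
    · rw [one_mul, one_mul, ← Real.exp_add, inv_mul_cancel_left₀ ha'.ne']
      ring_nf
    · simp
  calc ∫⁻ s, ENNReal.ofReal (Real.exp (-(a * s))) ∂expMeasure 1
      = ∫⁻ s, exponentialPDF 1 s * ENNReal.ofReal (Real.exp (-(a * s))) :=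
        lintegral_withDensity_eq_lintegral_mul _ (measurable_exponentialPDF 1) (by fun_prop)
    _ = ENNReal.ofReal (1 + a)⁻¹ := by
        simp_rw [htilt]
        rw [lintegral_const_mul _ (measurable_exponentialPDF _),
          lintegral_exponentialPDF_eq_one ha', mul_one]

lemma integral_expMeasure_one (f : ℝ → E) :
    ∫ s, f s ∂expMeasure 1 = ∫ s in Set.Ioi 0, Real.exp (-s) • f s := by
  rw [← integral_Ici_eq_integral_Ioi, ← integral_indicator measurableSet_Ici]
  refine (integral_withDensity_eq_integral_toReal_smul (measurable_exponentialPDF 1)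
    (ae_of_all _ fun s => by simp [exponentialPDF]) f).trans (integral_congr_ae
    (ae_of_all _ fun s => ?_))
  by_cases hs : 0 ≤ s
  · simp [exponentialPDF_eq, hs, ENNReal.toReal_ofReal (Real.exp_pos _).le]
  · simp [exponentialPDF_eq, hs]

/-- Conditioning on the first event of a Poisson clock gives the variation of constants formula. -/
lemma integral_ite_lt_expMeasure_one [CompleteSpace E] (c : E) {t : ℝ} (ht : 0 ≤ t)
    (hG : IntervalIntegrable G volume 0 t) :
    ∫ s, (if t < s then c else G (t - s)) ∂expMeasure 1 = duhamel c G t := by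
  set h : ℝ → E := fun s => Real.exp (-s) • if t < s then c else G (t - s)
  have hlate : Set.EqOn h (fun s => Real.exp (-s) • c) (Set.Ioi t) := fun s hs => by
    simp only [h, if_pos (Set.mem_Ioi.1 hs)]
  have hearly : Set.EqOn h (fun s => Real.exp (-t) • Real.exp (t - s) • G (t - s))
      (Set.uIoc 0 t) := fun s hs => by
    rw [Set.uIoc_of_le ht] at hs
    simp only [h, if_neg hs.2.not_gt, smul_smul, ← Real.exp_add]
    ring_nf
  have hearly_int : IntervalIntegrable h volume 0 t := by
    rw [intervalIntegrable_congr hearly]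
    have := (hG.continuousOn_smul Real.continuous_exp.continuousOn).comp_sub_left t
    rw [sub_self, sub_zero] at this
    exact this.symm.smul (Real.exp (-t))
  have hlate_int : IntegrableOn h (Set.Ioi t) :=
    IntegrableOn.congr_fun ((integrableOn_exp_neg_Ioi t).smul_const c) hlate.symm measurableSet_Ioi
  rw [integral_expMeasure_one, ← intervalIntegral.integral_interval_add_Ioi' hearly_int hlate_int,
    setIntegral_congr_fun measurableSet_Ioi hlate, integral_smul_const, integral_exp_neg_Ioi,
    intervalIntegral.integral_congr_ae (ae_of_all _ fun s hs => hearly hs),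
    intervalIntegral.integral_smul,
    intervalIntegral.integral_comp_sub_left fun u => Real.exp u • G u]
  simp only [sub_self, sub_zero, duhamel, smul_add, add_comm]

end

section

variable {N : ℕ} {τ : List (Fin N) → ℝ} {t : ℝ}

lemma birth_append (τ : List (Fin N) → ℝ) (v : List (Fin N)) (i : Fin N) :
    birth τ (v ++ [i]) = τ [] + birth (fun w => τ (w ++ [i])) v := by
  induction v with
  | nil => simp [birth]
  | cons j v ih =>
    simp only [List.cons_append, birth, ih]
    ring

lemma position_append (D : List (Fin N) → Fin N → ℝ) (v : List (Fin N)) (i : Fin N) :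
    position D (v ++ [i]) = D [] i + position (fun w => D (w ++ [i])) v := by
  induction v with
  | nil => simp [position]
  | cons j v ih =>
    simp only [List.cons_append, position, ih]
    ring

lemma birth_nonneg (hτ : ∀ v, 0 ≤ τ v) (v : List (Fin N)) : 0 ≤ birth τ v := by
  induction v with
  | nil => simp [birth]
  | cons j v ih => simpa [birth] using add_nonneg ih (hτ v)

lemma append_mem_alive {v : List (Fin N)} {i : Fin N} :
    v ++ [i] ∈ alive τ t ↔ v ∈ alive (fun w => τ (w ++ [i])) (t - τ []) := by
  simp only [alive, Set.mem_ofPred_eq, birth_append]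
  constructor <;> rintro ⟨h, h'⟩ <;> constructor <;> linarith

lemma alive_eq_singleton_of_lt (hτ : ∀ v, 0 ≤ τ v) (ht : 0 ≤ t) (h : t < τ []) :
    alive τ t = {[]} := by
  ext v
  rcases List.eq_nil_or_concat' v with rfl | ⟨w, i, rfl⟩
  · simp [alive, birth, ht, h]
  · have hborn := birth_nonneg (fun w => hτ (w ++ [i])) w
    simp only [alive, Set.mem_ofPred_eq, birth_append, Set.mem_singleton_iff,
      List.append_eq_nil_iff, List.cons_ne_nil, and_false, iff_false, not_and]
    intro
    linarith

lemma alive_eq_iUnion_of_le (h : τ [] ≤ t) :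
    alive τ t = ⋃ i, (· ++ [i]) '' alive (fun w => τ (w ++ [i])) (t - τ []) := by
  ext v
  rcases List.eq_nil_or_concat' v with rfl | ⟨w, i, rfl⟩
  · simp [alive, birth, h]
  · simp [append_mem_alive]

end

/-- The marks of a branching random walk: the lifetime of each particle, and the displacements of
its children. -/
abbrev Marks (N : ℕ) : Type := List (Fin N) → ℝ × (Fin N → ℝ)

section

variable {N : ℕ}

/-- The lifetimes recorded by a family of marks. -/
def lifetimes (x : Marks N) (v : List (Fin N)) : ℝ := (x v).1

/-- The displacements recorded by a family of marks. -/
def displacements (x : Marks N) (v : List (Fin N)) : Fin N → ℝ := (x v).2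

/-- The marks of the descendants of the `i`-th child of the initial particle. -/
def subtree (x : Marks N) (i : Fin N) : Marks N := fun v => x (v ++ [i])

/-- The product of `g (exp(position) ξ)` over the particles present at time `t`; it takes the
junk value `1` when infinitely many factors differ from `1`. -/
def aliveProduct (g : ℝ → ℂ) (x : Marks N) (t ξ : ℝ) : ℂ :=
  ∏ᶠ v ∈ alive (lifetimes x) t, g (Real.exp (position (displacements x) v) * ξ)

lemma aliveProduct_of_lt (g : ℝ → ℂ) {x : Marks N} (hx : ∀ v, 0 ≤ lifetimes x v) {t : ℝ}
    (ht : 0 ≤ t) (h : t < lifetimes x []) (ξ : ℝ) : aliveProduct g x t ξ = g ξ := by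
  simp [aliveProduct, alive_eq_singleton_of_lt hx ht h, position]

lemma aliveProduct_of_le (g : ℝ → ℂ) {x : Marks N} {t : ℝ} (hx : (alive (lifetimes x) t).Finite)
    (h : lifetimes x [] ≤ t) (ξ : ℝ) :
    aliveProduct g x t ξ = ∏ i, aliveProduct g (subtree x i) (t - lifetimes x [])
      (Real.exp (displacements x [] i) * ξ) := by
  have hinj (i : Fin N) : Function.Injective fun v : List (Fin N) => v ++ [i] :=
    fun v w hvw => by simpa using hvw
  have hdecomp := alive_eq_iUnion_of_le h
  have hdisj : Pairwise (Function.onFun Disjoint fun i : Fin N =>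
      (· ++ [i]) '' alive (lifetimes (subtree x i)) (t - lifetimes x [])) := by
    intro i j hij
    refine Set.disjoint_left.2 ?_
    rintro _ ⟨v, -, rfl⟩ ⟨w, -, hw⟩
    exact hij (by simpa using (List.append_inj' hw rfl).2.symm)
  rw [aliveProduct, hdecomp]
  refine (finprod_mem_iUnion hdisj fun i => hx.subset ?_).trans ?_
  · rw [hdecomp]
    exact Set.subset_iUnion (fun i : Fin N =>
      (· ++ [i]) '' alive (lifetimes (subtree x i)) (t - lifetimes x [])) i
  rw [finprod_eq_prod_of_fintype]
  refine Finset.prod_congr rfl fun i _ => ?_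
  rw [finprod_mem_image (hinj i).injOn]
  simp only [position_append, Real.exp_add, mul_comm (Real.exp (displacements x [] i)), mul_assoc,
    aliveProduct]
  rfl

lemma norm_aliveProduct_le_one {g : ℝ → ℂ} (hg : ∀ ξ, ‖g ξ‖ ≤ 1) (x : Marks N) (t ξ : ℝ) :
    ‖aliveProduct g x t ξ‖ ≤ 1 :=
  norm_finprod_mem_le_one fun _ _ => hg _

@[fun_prop]
lemma measurable_lifetimes (v : List (Fin N)) : Measurable fun x : Marks N => lifetimes x v := by
  unfold lifetimes; fun_prop

@[fun_prop]
lemma measurable_displacements (v : List (Fin N)) :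
    Measurable fun x : Marks N => displacements x v := by
  unfold displacements; fun_prop

@[fun_prop]
lemma measurable_subtree : Measurable (subtree : Marks N → Fin N → Marks N) := by
  unfold subtree; fun_prop

lemma measurable_birth (v : List (Fin N)) :
    Measurable fun x : Marks N => birth (lifetimes x) v := by
  induction v with
  | nil => simp [birth]
  | cons _ v ih => exact ih.add (measurable_lifetimes v)

lemma measurable_position (v : List (Fin N)) :
    Measurable fun x : Marks N => position (displacements x) v := by
  induction v with
  | nil => simp [position]
  | cons i v ih => exact ih.add ((measurable_pi_apply i).comp (measurable_displacements v))

lemma measurableSet_mem_alive (v : List (Fin N)) :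
    MeasurableSet {p : Marks N × ℝ | v ∈ alive (lifetimes p.1) p.2} :=
  have hbirth := (measurable_birth v).comp measurable_fst
  have hlife := (measurable_lifetimes v).comp measurable_fst
  (measurableSet_le hbirth measurable_snd).inter
    (measurableSet_lt measurable_snd (hbirth.add hlife))

lemma measurable_aliveProduct {g : ℝ → ℂ} (hg : Measurable g) :
    Measurable fun p : Marks N × ℝ × ℝ => aliveProduct g p.1 p.2.1 p.2.2 :=
  measurable_finprod_mem
    (fun v => (measurableSet_mem_alive v).preimage (f := fun p : Marks N × ℝ × ℝ => (p.1, p.2.1))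
      (by fun_prop))
    fun v => hg.comp (((measurable_position v).comp measurable_fst).exp.mul (by fun_prop))

end

/-- The law of i.i.d. marks with exponential lifetimes of parameter `1` and independent
displacement vectors with law `κ`. -/
def treeMeasure {N : ℕ} (κ : Measure (Fin N → ℝ)) : Measure (Marks N) :=
  Measure.infinitePi fun _ => (expMeasure 1).prod κ

section

variable {N : ℕ} (κ : Measure (Fin N → ℝ)) [IsProbabilityMeasure κ]

instance isProbabilityMeasure_treeMeasure : IsProbabilityMeasure (treeMeasure κ) := by
  unfold treeMeasure; infer_instance

lemma measurePreserving_root_subtree :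
    MeasurePreserving (fun x : Marks N => (x [], subtree x)) (treeMeasure κ)
      (((expMeasure 1).prod κ).prod (Measure.pi fun _ => treeMeasure κ)) :=
  ⟨by fun_prop, infinitePi_map_root_subtrees _⟩

lemma ae_lifetimes_nonneg : ∀ᵐ x ∂treeMeasure κ, ∀ v, 0 ≤ lifetimes x v := by
  rw [ae_all_iff]
  intro v
  have hroot : ∀ᵐ r ∂(expMeasure 1).prod κ, 0 ≤ r.1 :=
    Measure.quasiMeasurePreserving_fst.ae (ae_nonneg_expMeasure 1)
  exact (measurePreserving_eval_infinitePi
    (fun _ : List (Fin N) => (expMeasure 1).prod κ) v).quasiMeasurePreserving.ae hroot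

lemma lintegral_exp_neg_mul_birth {a : ℝ} (ha : 0 ≤ a) (v : List (Fin N)) :
    ∫⁻ x, ENNReal.ofReal (Real.exp (-(a * birth (lifetimes x) v))) ∂treeMeasure κ =
      ENNReal.ofReal (1 + a)⁻¹ ^ v.length := by
  induction v using List.reverseRecOn with
  | nil => simp [birth]
  | append_singleton v i ih =>
    set f : ℝ → ENNReal := fun s => ENNReal.ofReal (Real.exp (-(a * s)))
    have hf : Measurable f := by fun_prop
    have hsplit (x : Marks N) : f (birth (lifetimes x) (v ++ [i])) =
        f (x []).1 * f (birth (lifetimes (subtree x i)) v) := by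
      simp only [f]
      rw [birth_append, ← ENNReal.ofReal_mul (Real.exp_pos _).le, ← Real.exp_add, mul_add, neg_add]
      rfl
    have hroot : ∫⁻ r, f r.1 ∂(expMeasure 1).prod κ = ENNReal.ofReal (1 + a)⁻¹ :=
      (measurePreserving_fst.lintegral_comp hf).trans (lintegral_exp_neg_mul_expMeasure ha)
    have hsub : ∫⁻ y : Fin N → Marks N, f (birth (lifetimes (y i)) v)
        ∂Measure.pi (fun _ => treeMeasure κ) = ENNReal.ofReal (1 + a)⁻¹ ^ v.length :=
      ((measurePreserving_eval (fun _ => treeMeasure κ) i).lintegral_comp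
        (hf.comp (measurable_birth v))).trans ih
    calc ∫⁻ x, f (birth (lifetimes x) (v ++ [i])) ∂treeMeasure κ
        = ∫⁻ p, f p.1.1 * f (birth (lifetimes (p.2 i)) v)
            ∂((expMeasure 1).prod κ).prod (Measure.pi fun _ => treeMeasure κ) := by
          simp_rw [hsplit]
          exact (measurePreserving_root_subtree κ).lintegral_comp
            (f := fun p => f p.1.1 * f (birth (lifetimes (p.2 i)) v))
            ((hf.comp (by fun_prop)).mul ((hf.comp (measurable_birth v)).comp (by fun_prop)))
      _ = ENNReal.ofReal (1 + a)⁻¹ ^ (v ++ [i]).length := by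
          rw [lintegral_prod_mul (f := fun r : ℝ × (Fin N → ℝ) => f r.1)
            (g := fun y : Fin N → Marks N => f (birth (lifetimes (y i)) v)) (by fun_prop)
            ((hf.comp (measurable_birth v)).comp (measurable_pi_apply i)).aemeasurable,
            hroot, hsub, List.length_append, List.length_singleton, pow_succ']

end

lemma tsum_pow_length {α : Type*} [Fintype α] (c : ENNReal) :
    ∑' v : List α, c ^ v.length = (1 - Fintype.card α * c)⁻¹ := by
  rw [← (Equiv.sigmaFiberEquiv (List.length : List α → ℕ)).tsum_eq, ENNReal.tsum_sigma',
    ← ENNReal.tsum_geometric]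
  refine tsum_congr fun n => ?_
  change ∑' v : List.Vector α n, c ^ v.toList.length = _
  simp only [List.Vector.toList_length, tsum_fintype, Finset.sum_const, Finset.card_univ,
    card_vector, nsmul_eq_mul, Nat.cast_pow, mul_pow]

/-- Non-explosion: the expected number of `v` with `birth v ≤ t` is finite, since
`𝔼 ∑ exp (-N birth v)` is a geometric series of ratio `N / (1 + N)`. -/
lemma ae_finite_alive {N : ℕ} (κ : Measure (Fin N → ℝ)) [IsProbabilityMeasure κ] :
    ∀ᵐ x ∂treeMeasure κ, ∀ t, (alive (lifetimes x) t).Finite := by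
  set f : List (Fin N) → Marks N → ENNReal := fun v x =>
    ENNReal.ofReal (Real.exp (-(N * birth (lifetimes x) v)))
  have hf (v : List (Fin N)) : Measurable (f v) :=
    (((measurable_birth v).const_mul _).neg.exp).ennreal_ofReal
  have hratio : (N : ENNReal) * ENNReal.ofReal (1 + N : ℝ)⁻¹ < 1 := by
    rw [← ENNReal.ofReal_natCast, ← ENNReal.ofReal_mul N.cast_nonneg, ENNReal.ofReal_lt_one,
      mul_inv_lt_iff₀ (by positivity)]
    linarith
  have hsum : ∫⁻ x, ∑' v, f v x ∂treeMeasure κ ≠ ⊤ := by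
    rw [lintegral_tsum fun v => (hf v).aemeasurable]
    simp only [f, lintegral_exp_neg_mul_birth κ N.cast_nonneg, tsum_pow_length, Fintype.card_fin]
    exact ENNReal.inv_ne_top.2 (tsub_pos_of_lt hratio).ne'
  filter_upwards [ae_lt_top (Measurable.tsum hf) hsum] with x hx t
  refine (ENNReal.finite_const_le_of_tsum_ne_top hx.ne
    (ε := ENNReal.ofReal (Real.exp (-(N * t)))) (by simp [Real.exp_pos])).subset fun v hv => ?_
  have hborn : birth (lifetimes x) v ≤ t := hv.1
  simp only [f, Set.mem_ofPred_eq]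
  gcongr

section

variable {N : ℕ} {Ω : Type*} [MeasurableSpace Ω] {P : Measure Ω} {κ : Measure (Fin N → ℝ)}
  {τ : List (Fin N) → Ω → ℝ} {D : List (Fin N) → Ω → Fin N → ℝ}

lemma IsBranchingRandomWalk.measurable_marks (h : IsBranchingRandomWalk P κ τ D) :
    Measurable fun ω v => (τ v ω, D v ω) :=
  measurable_pi_lambda _ fun v => (h.measurable_lifetime v).prodMk (h.measurable_displacement v)

lemma IsBranchingRandomWalk.measurePreserving_marks (h : IsBranchingRandomWalk P κ τ D) :
    MeasurePreserving (fun ω v => (τ v ω, D v ω)) P (treeMeasure κ) := by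
  refine ⟨h.measurable_marks, ?_⟩
  rw [h.indep.map_fun_eq_infinitePi_map fun v =>
    (h.measurable_lifetime v).prodMk (h.measurable_displacement v), treeMeasure]
  simp_rw [h.law]

lemma IsBranchingRandomWalk.ae_finite_alive [IsProbabilityMeasure κ]
    (h : IsBranchingRandomWalk P κ τ D) :
    ∀ᵐ ω ∂P, ∀ t, (alive (fun v => τ v ω) t).Finite :=
  h.measurePreserving_marks.quasiMeasurePreserving.ae (KineticBRW.ae_finite_alive κ)

end

section

variable {N : ℕ} {Ω : Type*} [MeasurableSpace Ω] {P : Measure Ω} {A : Fin N → Ω → ℝ}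
  {f h : Fin N → ℝ → ℂ}

lemma integrable_prod_comp_mul [IsFiniteMeasure P] (hA : ∀ i, Measurable (A i))
    (hf : ∀ i, Measurable (f i)) (hf1 : ∀ i ξ, ‖f i ξ‖ ≤ 1) (ξ : ℝ) :
    Integrable (fun ω => ∏ i, f i (A i ω * ξ)) P :=
  .of_bound (Finset.measurable_prod _ fun i _ =>
      (hf i).comp ((hA i).mul_const ξ)).aestronglyMeasurable 1
    (ae_of_all _ fun _ => norm_prod_le_one _ fun i _ => hf1 i _)

lemma norm_smoothingOp_le_one [IsProbabilityMeasure P] (hf1 : ∀ i ξ, ‖f i ξ‖ ≤ 1) (ξ : ℝ) :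
    ‖smoothingOp P A f ξ‖ ≤ 1 := by
  simpa [smoothingOp] using norm_integral_le_of_norm_le_const (μ := P)
    (ae_of_all _ fun ω => norm_prod_le_one Finset.univ fun i _ => hf1 i (A i ω * ξ))

lemma measurable_smoothingOp [SFinite P] (hA : ∀ i, Measurable (A i)) {β : Type*}
    [MeasurableSpace β] {φ : β → ℝ → ℂ} (hφ : Measurable fun p : β × ℝ => φ p.1 p.2) (ξ : ℝ) :
    Measurable fun u => smoothingOp P A (fun _ => φ u) ξ := by
  have hint : Measurable fun p : β × Ω => ∏ i, φ p.1 (A i p.2 * ξ) :=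
    Finset.measurable_prod _ fun i _ =>
      hφ.comp (g := fun p : β × ℝ => φ p.1 p.2)
        (measurable_fst.prodMk (((hA i).comp measurable_snd).mul_const ξ))
  exact (hint.stronglyMeasurable.integral_prod_right' (ν := P)).measurable

lemma continuousAt_smoothingOp [IsFiniteMeasure P] (hA : ∀ i, Measurable (A i)) {φ : ℝ → ℝ → ℂ}
    (hφ : ∀ u, Measurable (φ u)) (hφ1 : ∀ u ξ, ‖φ u ξ‖ ≤ 1) {t : ℝ}
    (hφt : ∀ ξ, ContinuousAt (fun u => φ u ξ) t) (ξ : ℝ) :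
    ContinuousAt (fun u => smoothingOp P A (fun _ => φ u) ξ) t :=
  tendsto_integral_filter_of_dominated_convergence (fun _ => 1)
    (Eventually.of_forall fun u =>
      (integrable_prod_comp_mul hA (fun _ => hφ u) (fun _ => hφ1 u) ξ).aestronglyMeasurable)
    (Eventually.of_forall fun u => ae_of_all _ fun _ => norm_prod_le_one _ fun _ _ => hφ1 u _)
    (integrable_const 1)
    (ae_of_all _ fun _ => tendsto_finsetProd _ fun _ _ => hφt _)

lemma smoothingOp_map_log (hA : ∀ i, Measurable (A i)) (hApos : ∀ i, ∀ᵐ ω ∂P, 0 < A i ω)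
    (hf : ∀ i, Measurable (f i)) (ξ : ℝ) :
    smoothingOp (P.map fun ω i => Real.log (A i ω)) (fun i d => Real.exp (d i)) f ξ =
      smoothingOp P A f ξ := by
  have hint : Measurable fun d : Fin N → ℝ => ∏ i, f i (Real.exp (d i) * ξ) := by fun_prop
  rw [smoothingOp, integral_map (Measurable.aemeasurable (by fun_prop)) hint.aestronglyMeasurable]
  refine integral_congr_ae ?_
  filter_upwards [ae_all_iff.2 hApos] with ω hω
  exact Finset.prod_congr rfl fun i _ => by rw [Real.exp_log (hω i)]

lemma norm_prod_sub_prod_le {ι : Type*} (s : Finset ι) {a b : ι → ℂ} (ha : ∀ i ∈ s, ‖a i‖ ≤ 1)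
    (hb : ∀ i ∈ s, ‖b i‖ ≤ 1) : ‖∏ i ∈ s, a i - ∏ i ∈ s, b i‖ ≤ ∑ i ∈ s, ‖a i - b i‖ := by
  induction s using Finset.cons_induction with
  | empty => simp
  | cons j s hj ih =>
    rw [Finset.forall_mem_cons] at ha hb
    rw [Finset.prod_cons, Finset.prod_cons, Finset.sum_cons]
    calc ‖a j * ∏ i ∈ s, a i - b j * ∏ i ∈ s, b i‖
        = ‖(a j - b j) * ∏ i ∈ s, a i + b j * (∏ i ∈ s, a i - ∏ i ∈ s, b i)‖ := by ring_nf
      _ ≤ ‖a j - b j‖ * ‖∏ i ∈ s, a i‖ + ‖b j‖ * ‖∏ i ∈ s, a i - ∏ i ∈ s, b i‖ := by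
          simpa only [norm_mul] using
            norm_add_le ((a j - b j) * ∏ i ∈ s, a i) (b j * (∏ i ∈ s, a i - ∏ i ∈ s, b i))
      _ ≤ ‖a j - b j‖ + ∑ i ∈ s, ‖a i - b i‖ :=
          add_le_add (mul_le_of_le_one_right (norm_nonneg _) (norm_prod_le_one s ha.2))
            ((mul_le_of_le_one_left (norm_nonneg _) hb.1).trans (ih ha.2 hb.2))

lemma norm_smoothingOp_sub_le [IsProbabilityMeasure P] (hA : ∀ i, Measurable (A i))
    (hf : ∀ i, Measurable (f i)) (hh : ∀ i, Measurable (h i)) (hf1 : ∀ i ξ, ‖f i ξ‖ ≤ 1)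
    (hh1 : ∀ i ξ, ‖h i ξ‖ ≤ 1) {C : ℝ} (hC : ∀ i ξ, ‖f i ξ - h i ξ‖ ≤ C) (ξ : ℝ) :
    ‖smoothingOp P A f ξ - smoothingOp P A h ξ‖ ≤ N * C := by
  have hdiff (ω : Ω) : ‖∏ i, f i (A i ω * ξ) - ∏ i, h i (A i ω * ξ)‖ ≤ N * C := by
    refine (norm_prod_sub_prod_le _ (fun i _ => hf1 i _) fun i _ => hh1 i _).trans ?_
    simpa using Finset.sum_le_sum fun i (_ : i ∈ Finset.univ) => hC i (A i ω * ξ)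
  rw [smoothingOp, smoothingOp, ← integral_sub (integrable_prod_comp_mul hA hf hf1 ξ)
    (integrable_prod_comp_mul hA hh hh1 ξ)]
  simpa using norm_integral_le_of_norm_le_const (μ := P) (ae_of_all _ hdiff)

end

section

variable {N : ℕ} {Ω : Type*} [MeasurableSpace Ω] {P : Measure Ω} {A : Fin N → Ω → ℝ}
  {X₀ : Ω → ℝ} {φ ψ : ℝ → ℝ → ℂ} {t : ℝ}

lemma IsSolution.norm_le_one (hφ : IsSolution P A X₀ φ) (ht : 0 ≤ t) (ξ : ℝ) : ‖φ t ξ‖ ≤ 1 := by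
  obtain ⟨ρ, _, h⟩ := hφ.charFun_of_prob t ht
  exact h ξ ▸ norm_charFun_le_one ξ

lemma IsSolution.measurable (hφ : IsSolution P A X₀ φ) (ht : 0 ≤ t) : Measurable (φ t) := by
  obtain ⟨ρ, _, h⟩ := hφ.charFun_of_prob t ht
  rw [funext h]
  exact measurable_charFun

/-- The weight `exp (2 (N + 1) t)` makes the Cauchy problem a contraction, as `N + 1` is a
Lipschitz constant of its right-hand side. -/
lemma IsSolution.norm_sub_le_half [IsProbabilityMeasure P] (hA : ∀ i, Measurable (A i))
    (hφ : IsSolution P A X₀ φ) (hψ : IsSolution P A X₀ ψ) {C : ℝ}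
    (hC : ∀ s, 0 ≤ s → ∀ ξ, ‖ψ s ξ - φ s ξ‖ ≤ C * Real.exp (2 * (N + 1) * s)) (ht : 0 ≤ t)
    (ξ : ℝ) : ‖ψ t ξ - φ t ξ‖ ≤ C / 2 * Real.exp (2 * (N + 1) * t) := by
  have hC0 : 0 ≤ C := by simpa using (norm_nonneg _).trans (hC 0 le_rfl 0)
  choose! dφ hdφ heφ using fun s hs => hφ.equation s hs ξ
  choose! dψ hdψ heψ using fun s hs => hψ.equation s hs ξ
  have hbound (s : ℝ) : HasDerivAt (fun s => C / 2 * Real.exp (2 * (N + 1) * s))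
      ((N + 1) * (C * Real.exp (2 * (N + 1) * s))) s := by
    convert! (((hasDerivAt_id s).const_mul (2 * (N + 1 : ℝ))).exp).const_mul (C / 2) using 1
    simp only [id]
    ring
  refine norm_le_of_norm_deriv_le (f := fun s => ψ s ξ - φ s ξ) ht
    (((hψ.continuous_time ξ).sub (hφ.continuous_time ξ)).mono Set.Icc_subset_Ici_self)
    (fun s hs => (hdψ s hs.1).sub (hdφ s hs.1))
    (fun s _ => (hbound s).continuousAt.continuousWithinAt) (fun s _ => hbound s) ?_
    fun s hs => ?_
  · simpa [hφ.initial, hψ.initial] using by positivity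
  · have hs0 := hs.1.le
    have hgain := norm_smoothingOp_sub_le (P := P) hA (fun _ => hψ.measurable hs0)
      (fun _ => hφ.measurable hs0) (fun _ => hψ.norm_le_one hs0) (fun _ => hφ.norm_le_one hs0)
      (fun _ => hC s hs0) ξ
    calc ‖dψ s - dφ s‖
        = ‖(smoothingOp P A (fun _ => ψ s) ξ - smoothingOp P A (fun _ => φ s) ξ) -
            (ψ s ξ - φ s ξ)‖ := by
          rw [← heψ s hs.1, ← heφ s hs.1]
          ring_nf
      _ ≤ N * (C * Real.exp (2 * (N + 1) * s)) + C * Real.exp (2 * (N + 1) * s) :=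
          norm_sub_le_of_le hgain (hC s hs0 ξ)
      _ = (N + 1) * (C * Real.exp (2 * (N + 1) * s)) := by ring

theorem IsSolution.unique [IsProbabilityMeasure P] (hA : ∀ i, Measurable (A i))
    (hφ : IsSolution P A X₀ φ) (hψ : IsSolution P A X₀ ψ) (ht : 0 ≤ t) (ξ : ℝ) :
    ψ t ξ = φ t ξ := by
  have hiter (n : ℕ) : ∀ s, 0 ≤ s → ∀ ξ,
      ‖ψ s ξ - φ s ξ‖ ≤ 2 * (1 / 2) ^ n * Real.exp (2 * (N + 1) * s) := by
    induction n with
    | zero =>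
      intro s hs ξ
      have hexp : 1 ≤ Real.exp (2 * (N + 1) * s) := Real.one_le_exp (by positivity)
      have hnorm := norm_sub_le_of_le (hψ.norm_le_one hs ξ) (hφ.norm_le_one hs ξ)
      linarith
    | succ n ih =>
      intro s hs ξ
      convert hφ.norm_sub_le_half hA hψ ih hs ξ using 2
      ring
  have hlim : Tendsto (fun n : ℕ => 2 * (1 / 2) ^ n * Real.exp (2 * (N + 1) * t)) atTop (𝓝 0) := by
    simpa using ((tendsto_pow_atTop_nhds_zero_of_lt_one (by norm_num) one_half_lt_one).const_mul
      (2 : ℝ)).mul_const (Real.exp (2 * (N + 1) * t))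
  exact sub_eq_zero.1 (norm_le_zero_iff.1 (ge_of_tendsto' hlim fun n => hiter n t ht ξ))

end

/-- The expected product of `g (exp(position) ξ)` over the particles present at time `t`. -/
def expectedProduct {N : ℕ} (κ : Measure (Fin N → ℝ)) (g : ℝ → ℂ) (t ξ : ℝ) : ℂ :=
  ∫ x, aliveProduct g x t ξ ∂treeMeasure κ

/-- The right-hand side of the Cauchy problem, along the expected products at time `u`. -/
def gain {N : ℕ} (κ : Measure (Fin N → ℝ)) (g : ℝ → ℂ) (ξ u : ℝ) : ℂ :=
  smoothingOp κ (fun i d => Real.exp (d i)) (fun _ => expectedProduct κ g u) ξ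

section

variable {N : ℕ} (κ : Measure (Fin N → ℝ)) [IsProbabilityMeasure κ] {g : ℝ → ℂ}

lemma norm_expectedProduct_le_one (hg1 : ∀ ξ, ‖g ξ‖ ≤ 1) (t ξ : ℝ) :
    ‖expectedProduct κ g t ξ‖ ≤ 1 := by
  simpa [expectedProduct] using norm_integral_le_of_norm_le_const (μ := treeMeasure κ)
    (ae_of_all _ fun x => norm_aliveProduct_le_one hg1 x t ξ)

lemma measurable_expectedProduct (hg : Measurable g) :
    Measurable fun p : ℝ × ℝ => expectedProduct κ g p.1 p.2 :=
  ((measurable_aliveProduct hg).stronglyMeasurable.integral_prod_left'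
    (μ := treeMeasure κ)).measurable

lemma norm_gain_le_one (hg1 : ∀ ξ, ‖g ξ‖ ≤ 1) (ξ u : ℝ) : ‖gain κ g ξ u‖ ≤ 1 :=
  norm_smoothingOp_le_one (fun _ => norm_expectedProduct_le_one κ hg1 u) ξ

lemma measurable_gain (hg : Measurable g) (ξ : ℝ) : Measurable (gain κ g ξ) :=
  measurable_smoothingOp (fun _ => by fun_prop) (measurable_expectedProduct κ hg) ξ

lemma intervalIntegrable_gain (hg : Measurable g) (hg1 : ∀ ξ, ‖g ξ‖ ≤ 1) (ξ a b : ℝ) :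
    IntervalIntegrable (gain κ g ξ) volume a b :=
  (intervalIntegrable_const (c := (1 : ℝ))).mono_fun (measurable_gain κ hg ξ).aestronglyMeasurable
    (ae_of_all _ fun u => by simpa using norm_gain_le_one κ hg1 ξ u)

lemma aliveProduct_ae_eq (g : ℝ → ℂ) {t : ℝ} (ht : 0 ≤ t) (ξ : ℝ) :
    ∀ᵐ x ∂treeMeasure κ, aliveProduct g x t ξ = if t < (x []).1 then g ξ else
      ∏ i, aliveProduct g (subtree x i) (t - (x []).1) (Real.exp ((x []).2 i) * ξ) := by
  filter_upwards [ae_lifetimes_nonneg κ, ae_finite_alive κ] with x hx hfin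
  split_ifs with h
  · exact aliveProduct_of_lt g hx ht h ξ
  · exact aliveProduct_of_le g (hfin t) (not_lt.1 h) ξ

lemma expectedProduct_eq_duhamel (hg : Measurable g) (hg1 : ∀ ξ, ‖g ξ‖ ≤ 1) {t : ℝ} (ht : 0 ≤ t)
    (ξ : ℝ) : expectedProduct κ g t ξ = duhamel (g ξ) (gain κ g ξ) t := by
  set F : (ℝ × (Fin N → ℝ)) × (Fin N → Marks N) → ℂ := fun p => if t < p.1.1 then g ξ else
    ∏ i, aliveProduct g (p.2 i) (t - p.1.1) (Real.exp (p.1.2 i) * ξ)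
  have hF : Measurable F := by
    refine .ite (measurableSet_lt measurable_const (by fun_prop)) measurable_const
      (Finset.measurable_prod _ fun i _ => ?_)
    exact (measurable_aliveProduct hg).comp (f := fun p : (ℝ × (Fin N → ℝ)) × (Fin N → Marks N) =>
      (p.2 i, t - p.1.1, Real.exp (p.1.2 i) * ξ)) (by fun_prop)
  have hF1 (p) : ‖F p‖ ≤ 1 := by
    simp only [F]
    split_ifs
    exacts [hg1 ξ, norm_prod_le_one _ fun i _ => norm_aliveProduct_le_one hg1 _ _ _]
  have hFint : Integrable F (((expMeasure 1).prod κ).prod (Measure.pi fun _ => treeMeasure κ)) :=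
    .of_bound hF.aestronglyMeasurable 1 (ae_of_all _ hF1)
  have hsub (r : ℝ × (Fin N → ℝ)) : ∫ y, F (r, y) ∂Measure.pi (fun _ => treeMeasure κ) =
      if t < r.1 then g ξ else ∏ i, expectedProduct κ g (t - r.1) (Real.exp (r.2 i) * ξ) := by
    simp only [F]
    split_ifs
    · simp
    · exact integral_fintype_prod_eq_prod fun i y =>
        aliveProduct g y (t - r.1) (Real.exp (r.2 i) * ξ)
  have hroot (s : ℝ) : ∫ d, ∫ y, F ((s, d), y) ∂Measure.pi (fun _ => treeMeasure κ) ∂κ =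
      if t < s then g ξ else gain κ g ξ (t - s) := by
    simp only [hsub]
    split_ifs
    · simp
    · rfl
  calc expectedProduct κ g t ξ
      = ∫ x, F (x [], subtree x) ∂treeMeasure κ := integral_congr_ae (aliveProduct_ae_eq κ g ht ξ)
    _ = ∫ p, F p ∂((expMeasure 1).prod κ).prod (Measure.pi fun _ => treeMeasure κ) := by
        rw [← (measurePreserving_root_subtree κ).map_eq,
          integral_map (by fun_prop) hF.aestronglyMeasurable]
    _ = ∫ s, (if t < s then g ξ else gain κ g ξ (t - s)) ∂expMeasure 1 := by
        rw [integral_prod _ hFint, integral_prod _ hFint.integral_prod_left]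
        simp only [hroot]
    _ = duhamel (g ξ) (gain κ g ξ) t :=
        integral_ite_lt_expMeasure_one _ ht (intervalIntegrable_gain κ hg hg1 ξ 0 t)

lemma continuousOn_expectedProduct (hg : Measurable g) (hg1 : ∀ ξ, ‖g ξ‖ ≤ 1) (ξ : ℝ) :
    ContinuousOn (fun t => expectedProduct κ g t ξ) (Set.Ici 0) :=
  (continuous_duhamel (g ξ) (intervalIntegrable_gain κ hg hg1 ξ)).continuousOn.congr
    fun _ ht => expectedProduct_eq_duhamel κ hg hg1 ht ξ

lemma continuousAt_gain (hg : Measurable g) (hg1 : ∀ ξ, ‖g ξ‖ ≤ 1) (ξ : ℝ) {t : ℝ} (ht : 0 < t) :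
    ContinuousAt (gain κ g ξ) t :=
  continuousAt_smoothingOp (fun _ => by fun_prop)
    (fun _ => (measurable_expectedProduct κ hg).comp measurable_prodMk_left)
    (fun u => norm_expectedProduct_le_one κ hg1 u)
    (fun η => (continuousOn_expectedProduct κ hg hg1 η).continuousAt (Ici_mem_nhds ht)) ξ

lemma hasDerivAt_expectedProduct (hg : Measurable g) (hg1 : ∀ ξ, ‖g ξ‖ ≤ 1) {t : ℝ} (ht : 0 < t)
    (ξ : ℝ) :
    HasDerivAt (fun s => expectedProduct κ g s ξ) (gain κ g ξ t - expectedProduct κ g t ξ) t := by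
  rw [expectedProduct_eq_duhamel κ hg hg1 ht.le]
  refine (hasDerivAt_duhamel (g ξ) (intervalIntegrable_gain κ hg hg1 ξ 0 t)
    (measurable_gain κ hg ξ).stronglyMeasurable
    (continuousAt_gain κ hg hg1 ξ ht)).congr_of_eventuallyEq ?_
  filter_upwards [Ioi_mem_nhds ht] with s hs
  exact expectedProduct_eq_duhamel κ hg hg1 (le_of_lt hs) ξ

end

section

variable {N : ℕ}

/-- The law of the sum of `exp(position) U` over the particles present at time `t`, where the `U`
are i.i.d. with law `ν`, one for each particle. -/
def aliveSumLaw (κ : Measure (Fin N → ℝ)) (ν : Measure ℝ) (t : ℝ) : Measure ℝ :=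
  ((treeMeasure κ).prod (Measure.infinitePi fun _ : List (Fin N) => ν)).map fun p =>
    ∑ᶠ v ∈ alive (lifetimes p.1) t, Real.exp (position (displacements p.1) v) * p.2 v

lemma measurable_aliveSum (t : ℝ) : Measurable fun p : Marks N × (List (Fin N) → ℝ) =>
    ∑ᶠ v ∈ alive (lifetimes p.1) t, Real.exp (position (displacements p.1) v) * p.2 v :=
  measurable_finsum_mem
    (fun v => (measurableSet_mem_alive v).preimage
      (f := fun p : Marks N × (List (Fin N) → ℝ) => (p.1, t)) (by fun_prop))
    fun v => ((measurable_position v).comp measurable_fst).exp.mul (by fun_prop)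

variable (κ : Measure (Fin N → ℝ)) [IsProbabilityMeasure κ] (ν : Measure ℝ)
  [IsProbabilityMeasure ν]

instance isProbabilityMeasure_aliveSumLaw (t : ℝ) : IsProbabilityMeasure (aliveSumLaw κ ν t) :=
  Measure.isProbabilityMeasure_map (measurable_aliveSum t).aemeasurable

lemma charFun_aliveSumLaw (t ξ : ℝ) :
    charFun (aliveSumLaw κ ν t) ξ = expectedProduct κ (charFun ν) t ξ := by
  rw [aliveSumLaw, charFun_map_prod (measurable_aliveSum t), expectedProduct]
  refine integral_congr_ae ?_
  filter_upwards [ae_finite_alive κ] with x hx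
  simp only [finsum_mem_eq_finite_toFinset_sum _ (hx t), charFun_map_sum_mul_infinitePi,
    aliveProduct, finprod_mem_eq_finite_toFinset_prod _ (hx t)]

end

lemma isSolution_expectedProduct {N : ℕ} {Ω : Type*} [MeasurableSpace Ω] {P : Measure Ω}
    [IsProbabilityMeasure P] {A : Fin N → Ω → ℝ} (hA : ∀ i, Measurable (A i))
    (hApos : ∀ i, ∀ᵐ ω ∂P, 0 < A i ω) {X₀ : Ω → ℝ}
    [IsProbabilityMeasure (P.map fun ω i => Real.log (A i ω))] [IsProbabilityMeasure (P.map X₀)] :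
    IsSolution P A X₀
      (expectedProduct (P.map fun ω i => Real.log (A i ω)) (charFun (P.map X₀))) := by
  set κ := P.map fun ω i => Real.log (A i ω)
  set g := charFun (P.map X₀)
  have hg : Measurable g := measurable_charFun
  have hg1 : ∀ ξ, ‖g ξ‖ ≤ 1 := fun ξ => norm_charFun_le_one ξ
  refine ⟨fun t _ => ⟨aliveSumLaw κ (P.map X₀) t, inferInstance,
      fun ξ => (charFun_aliveSumLaw κ (P.map X₀) t ξ).symm⟩,
    fun ξ => by rw [expectedProduct_eq_duhamel κ hg hg1 le_rfl, duhamel_zero],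
    continuousOn_expectedProduct κ hg hg1, fun t ht ξ =>
    ⟨_, hasDerivAt_expectedProduct κ hg hg1 ht ξ, ?_⟩⟩
  rw [sub_add_cancel]
  exact smoothingOp_map_log hA hApos
    (fun _ => (measurable_expectedProduct κ hg).comp measurable_prodMk_left) ξ

section

variable {N : ℕ} {t : ℝ}

lemma walk_eq_sum_toFinset {τ : List (Fin N) → ℝ} (D : List (Fin N) → Fin N → ℝ)
    (h : (alive τ t).Finite) :
    walk τ D t = ∑ v ∈ h.toFinset, Measure.dirac (position D v) := by
  rw [walk, ← Measure.sum_coe_finset]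
  exact (Measure.sum_comp_equiv (Equiv.subtypeEquivRight fun v => h.mem_toFinset)
    fun v : alive τ t => Measure.dirac (position D v)).symm

lemma aliveProduct_eq_prod_of_walk_eq (g : ℝ → ℂ) {x : Marks N}
    (h : (alive (lifetimes x) t).Finite) {ι : Type*} {s : Finset ι} {z : ι → ℝ}
    (hwalk : walk (lifetimes x) (displacements x) t = ∑ k ∈ s, Measure.dirac (z k)) (ξ : ℝ) :
    aliveProduct g x t ξ = ∏ k ∈ s, g (Real.exp (z k) * ξ) := by
  rw [aliveProduct, finprod_mem_eq_finite_toFinset_prod _ h]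
  exact prod_eq_prod_of_sum_dirac_eq ((walk_eq_sum_toFinset _ h).symm.trans hwalk)
    fun y => g (Real.exp y * ξ)

lemma measurable_yule (t : ℝ) : Measurable fun x : Marks N => yule (lifetimes x) t := by
  simp only [yule, ← finsum_one]
  exact measurable_finsum_mem
    (fun v => (measurableSet_mem_alive v).preimage (f := fun x : Marks N => (x, t)) (by fun_prop))
    fun _ => measurable_const

end

lemma measurable_sum_range_exp_mul :
    Measurable fun p : (ℕ × (ℕ → ℝ)) × (ℕ → ℝ) =>
      ∑ k ∈ Finset.range p.1.1, Real.exp (p.1.2 k) * p.2 k := by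
  have hsum : Measurable fun q : ((ℕ → ℝ) × (ℕ → ℝ)) × ℕ =>
      ∑ k ∈ Finset.range q.2, Real.exp (q.1.1 k) * q.1.2 k :=
    measurable_from_prod_countable_left fun n => by
      dsimp only
      fun_prop
  exact hsum.comp (f := fun p : (ℕ × (ℕ → ℝ)) × (ℕ → ℝ) => ((p.1.2, p.2), p.1.1)) (by fun_prop)

section

variable {N : ℕ} {Ω : Type*} [MeasurableSpace Ω] {P : Measure Ω} {κ : Measure (Fin N → ℝ)}
  {τ : List (Fin N) → Ω → ℝ} {D : List (Fin N) → Ω → Fin N → ℝ} {z : ℝ → ℕ → Ω → ℝ}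

lemma IsBranchingRandomWalk.measurable_configuration (h : IsBranchingRandomWalk P κ τ D)
    (hz : IsLocationList P τ D z) (t : ℝ) :
    Measurable fun ω => (yule (fun v => τ v ω) t, fun k => z t k ω) :=
  ((measurable_yule t).comp h.measurable_marks).prodMk
    (measurable_pi_lambda _ fun k => hz.measurable_location t k)

lemma IsBranchingRandomWalk.measurable_weightedSum (h : IsBranchingRandomWalk P κ τ D)
    (hz : IsLocationList P τ D z) (t : ℝ) :
    Measurable fun p : Ω × (ℕ → ℝ) => weightedSum τ z t p.1 p.2 :=
  measurable_sum_range_exp_mul.comp ((h.measurable_configuration hz t).prodMap measurable_id)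

variable [IsProbabilityMeasure P]

lemma IsBranchingRandomWalk.charFun_smoothingTransform [IsProbabilityMeasure κ]
    (h : IsBranchingRandomWalk P κ τ D) (hz : IsLocationList P τ D z) (ν : Measure ℝ)
    [IsProbabilityMeasure ν] {t : ℝ} (ht : 0 ≤ t) (ξ : ℝ) :
    charFun (smoothingTransform P τ z t ν) ξ = expectedProduct κ (charFun ν) t ξ := by
  have hprod : Measurable fun x : Marks N => aliveProduct (charFun ν) x t ξ :=
    (measurable_aliveProduct measurable_charFun).comp (f := fun x : Marks N => (x, t, ξ))
      (by fun_prop)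
  rw [smoothingTransform, charFun_map_prod (h.measurable_weightedSum hz t), expectedProduct,
    ← h.measurePreserving_marks.map_eq,
    integral_map h.measurable_marks.aemeasurable hprod.aestronglyMeasurable]
  refine integral_congr_ae ?_
  filter_upwards [h.ae_finite_alive, hz.walk_eq t ht] with ω hfin hwalk
  have hleft := charFun_map_sum_mul_infinitePi ν (Finset.range (yule (fun v => τ v ω) t))
    (fun k => Real.exp (z t k ω)) ξ
  have hright := aliveProduct_eq_prod_of_walk_eq (x := fun v => (τ v ω, D v ω)) (charFun ν)
    (hfin t) (hwalk (hfin t)) ξ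
  exact hleft.trans hright.symm

lemma IsInitialSample.map_weightedSum {ν : Measure ℝ} [IsProbabilityMeasure ν] {X : ℕ → Ω → ℝ}
    (hX : IsInitialSample P ν τ z X) (h : IsBranchingRandomWalk P κ τ D)
    (hz : IsLocationList P τ D z) {t : ℝ} (ht : 0 ≤ t) :
    P.map (fun ω => weightedSum τ z t ω fun k => X k ω) = smoothingTransform P τ z t ν := by
  have hconf := h.measurable_configuration hz t
  have hXm : Measurable fun ω k => X k ω := measurable_pi_lambda _ hX.measurable_sample
  have hlaw : P.map (fun ω k => X k ω) = Measure.infinitePi fun _ : ℕ => ν := by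
    rw [hX.indep.map_fun_eq_infinitePi_map hX.measurable_sample]
    simp_rw [hX.law]
  have hjoint : P.map (fun ω => ((yule (fun v => τ v ω) t, fun k => z t k ω), fun k => X k ω)) =
      (P.prod (Measure.infinitePi fun _ : ℕ => ν)).map
        (Prod.map (fun ω => (yule (fun v => τ v ω) t, fun k => z t k ω)) id) := by
    rw [(indepFun_iff_map_prod_eq_prod_map_map hconf.aemeasurable hXm.aemeasurable).1
      (hX.indep_walk t ht), hlaw, ← Measure.map_prod_map _ _ hconf measurable_id, Measure.map_id]
  have := congrArg (Measure.map fun p : (ℕ × (ℕ → ℝ)) × (ℕ → ℝ) =>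
    ∑ k ∈ Finset.range p.1.1, Real.exp (p.1.2 k) * p.2 k) hjoint
  rwa [Measure.map_map measurable_sum_range_exp_mul (hconf.prodMk hXm),
    Measure.map_map measurable_sum_range_exp_mul (hconf.prodMap measurable_id)] at this

lemma IsBranchingRandomWalk.integral_exp_sum [IsProbabilityMeasure κ]
    (h : IsBranchingRandomWalk P κ τ D) (hz : IsLocationList P τ D z) {ν : Measure ℝ}
    [IsProbabilityMeasure ν] {X : ℕ → Ω → ℝ} (hX : IsInitialSample P ν τ z X) {t : ℝ}
    (ht : 0 ≤ t) (ξ : ℝ) :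
    ∫ ω, Complex.exp (Complex.I * ξ * ((∑ k ∈ Finset.range (yule (fun v => τ v ω) t),
      Real.exp (z t k ω) * X k ω : ℝ) : ℂ)) ∂P = expectedProduct κ (charFun ν) t ξ := by
  have hS : Measurable fun ω => weightedSum τ z t ω fun k => X k ω :=
    (h.measurable_weightedSum hz t).comp (f := fun ω => (ω, fun k => X k ω))
      (measurable_id.prodMk (measurable_pi_lambda _ hX.measurable_sample))
  rw [← h.charFun_smoothingTransform hz ν ht, ← hX.map_weightedSum h hz ht, charFun_apply_real,
    integral_map hS.aemeasurable (by fun_prop)]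
  refine integral_congr_ae (ae_of_all _ fun ω => congrArg Complex.exp ?_)
  rw [weightedSum, mul_assoc, mul_comm Complex.I]

end

end

end KineticBRW

open MeasureTheory ProbabilityTheory KineticBRW in
theorem proposition2p1 {N : ℕ} (hN : 0 < N)
    {Ω : Type*} [MeasurableSpace Ω] (P : Measure Ω) [IsProbabilityMeasure P]
    (A : Fin N → Ω → ℝ) (hA : ∀ i, Measurable (A i)) (hApos : ∀ i, ∀ᵐ ω ∂P, 0 < A i ω)
    (X₀ : Ω → ℝ) (hX₀ : Measurable X₀) :
    ∃ φ : ℝ → ℝ → ℂ,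
      IsSolution P A X₀ φ ∧
      (∀ ψ : ℝ → ℝ → ℂ, IsSolution P A X₀ ψ → ∀ t : ℝ, 0 ≤ t → ∀ ξ : ℝ, ψ t ξ = φ t ξ) ∧
      ∀ (Ω' : Type*) [MeasurableSpace Ω'] (P' : Measure Ω') [IsProbabilityMeasure P']
        (τ : List (Fin N) → Ω' → ℝ) (D : List (Fin N) → Ω' → Fin N → ℝ) (z : ℝ → ℕ → Ω' → ℝ),
        IsBranchingRandomWalk P' (P.map fun ω i => Real.log (A i ω)) τ D →
        IsLocationList P' τ D z →
        (∀ X : ℕ → Ω' → ℝ, IsInitialSample P' (P.map X₀) τ z X →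
          ∀ t : ℝ, 0 ≤ t → ∀ ξ : ℝ,
            φ t ξ = ∫ ω, Complex.exp (Complex.I * ξ *
              ((∑ k ∈ Finset.range (yule (fun v => τ v ω) t),
                Real.exp (z t k ω) * X k ω : ℝ) : ℂ)) ∂P') ∧
        (haveI : IsProbabilityMeasure (P.map X₀) :=
            Measure.isProbabilityMeasure_map hX₀.aemeasurable
          ∀ t : ℝ, 0 ≤ t → ∀ ξ : ℝ,
            φ t ξ = charFun (smoothingTransform P' τ z t (P.map X₀)) ξ) := by
  have hκ : IsProbabilityMeasure (P.map fun ω i => Real.log (A i ω)) :=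
    Measure.isProbabilityMeasure_map (Measurable.aemeasurable (by fun_prop))
  have hν : IsProbabilityMeasure (P.map X₀) := Measure.isProbabilityMeasure_map hX₀.aemeasurable
  have hsol := isSolution_expectedProduct hA hApos (X₀ := X₀)
  refine ⟨_, hsol, fun ψ hψ t ht ξ => hsol.unique hA hψ ht ξ, ?_⟩
  intro Ω' _ P' _ τ D z h hz
  exact ⟨fun X hX t ht ξ => (h.integral_exp_sum hz hX ht ξ).symm,
    fun t ht ξ => (h.charFun_smoothingTransform hz (P.map X₀) ht ξ).symm⟩
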